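/- Let $M$ be a finite set of items and let $v : 2^M \to \mathbb{R}_{\ge 0}$ be a valuation, that is, $v(\emptyset)=0$ and $v(S)\le v(T)$ whenever $S\subseteq T$. A price vector is a vector $\mathbf{p}\in\mathbb{R}_{\ge 0}^M$; the utility of a bundle $S\subseteq M$ at prices $\mathbf{p}$ is $u(S,\mathbf{p}) = v(S)-\sum_{x\in S}p_x$, and $D_{\mathbf{p}}(v)$ denotes the set of bundles maximizing $u(\cdot,\mathbf{p})$ over all subsets of $M$. The valuation $v$ is gross-substitutes if for any two price vectors $\mathbf{p}\le\mathbf{q}$ (pointwise) and any $A\in D_{\mathbf{p}}(v)$ there is $B\in D_{\mathbf{q}}(v)$ with $A\cap\{x\in M : p_x=q_x\}\subseteq B$. Theorem. If $v$ is not gross-substitutes, then there are bundles $A,B\subseteq M$ and a price vector $\mathbf{p}\in\mathbb{R}_{\ge 0}^M$ such that (1) $|B\setminus A| = 2$; (2) $|A\setminus B|\le 1$; (3) $B\in\arg\min_{C\subseteq M\,:\,u(C,\mathbf{p})>u(A,\mathbf{p})}\,|(C\setminus A)\cup(A\setminus C)|$; in particular $u(B,\mathbf{p})>u(A,\mathbf{p})$.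 -/

import Mathlib

open scoped NNReal

/-- A valuation on the bundles of items of `M`: a normalized, monotone function with
nonnegative values. -/
structure BundleValuation (M : Type*) where
  toFun : Finset M → ℝ≥0
  map_empty : toFun ∅ = 0
  mono : ∀ S T : Finset M, S ⊆ T → toFun S ≤ toFun T

instance {M : Type*} : CoeFun (BundleValuation M) (fun _ => Finset M → ℝ≥0) := ⟨BundleValuation.toFun⟩

/-- A price vector assigns a nonnegative real price to every item. -/
abbrev PriceVector (M : Type*) := M → ℝ≥0

/-- The quasi-linear utility `u(S, p) = v(S) - ∑ x ∈ S, p x`. -/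
def utility {M : Type*} (v : BundleValuation M) (S : Finset M) (p : PriceVector M) : ℝ :=
  (v S : ℝ) - ∑ x ∈ S, (p x : ℝ)

/-- The demand correspondence: the utility-maximizing bundles at the prices `p`. -/
def demand {M : Type*} (v : BundleValuation M) (p : PriceVector M) : Set (Finset M) :=
  {S | ∀ T : Finset M, utility v T p ≤ utility v S p}

/-- Gross substitutes: if prices rise from `p` to `q`, every bundle demanded at `p` can be
replaced by a bundle demanded at `q` that retains all its items whose price did not change. -/
def IsGrossSubstitutes {M : Type*} (v : BundleValuation M) : Prop :=
  ∀ p q : PriceVector M, p ≤ q → ∀ A ∈ demand v p, ∃ B ∈ demand v q,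
    (A : Set M) ∩ {x | p x = q x} ⊆ (B : Set M)

/-- The bundles `C` in the family `F` at which `f` attains its minimum over `F`. -/
def bundleArgmin {M : Type*} (F : Set (Finset M)) (f : Finset M → ℕ) : Set (Finset M) :=
  {C | C ∈ F ∧ ∀ D ∈ F, f C ≤ f D}

/-! Gross substitutes follows from two local conditions, `PairSubmodular` and `TripleCondition`, so
`v` violates one of them. For this implication, dummy items turn `v` into a function on larger sets
that satisfies the three-term Plücker relation. Local exchange then yields global exchange
(`LocalExchange.exchange`), and exchange moves a bundle demanded at the new prices towards `A`.

A violation yields the prices: items of `S` are free, items outside the violating pair or triple are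
prohibitive, and the remaining prices make `S ∪ {i, j}` the only bundle in between that beats `S`
(pair) or `S ∪ {k}` (triple). -/

/-! ### Valuated matroids: from local to global exchange -/

/-- Local exchange for set functions: the three-term Plücker relation of valuated matroids. -/
def LocalExchange {N : Type*} [DecidableEq N] (F : Finset N → ℝ) : Prop :=
  ∀ (X : Finset N) (a b c d : N), a ∉ X → b ∉ X → c ∉ X → d ∉ X →
    a ≠ b → a ≠ c → a ≠ d → b ≠ c → b ≠ d → c ≠ d →
    F (insert a (insert b X)) + F (insert c (insert d X)) ≤
      max (F (insert a (insert c X)) + F (insert b (insert d X)))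
        (F (insert a (insert d X)) + F (insert b (insert c X)))

/-- Local exchange is preserved by adding a linear weight. -/
lemma LocalExchange.add_weight {N : Type*} [DecidableEq N] {F : Finset N → ℝ}
    (hF : LocalExchange F) (w : N → ℝ) : LocalExchange fun S => F S + ∑ x ∈ S, w x := by
  intro X a b c d ha hb hc hd hab hac had hbc hbd hcd
  have h := hF X a b c d ha hb hc hd hab hac had hbc hbd hcd
  simp only [Finset.sum_insert, Finset.mem_insert, not_or, ha, hb, hc, hd, hab, hac, had, hbc,
    hbd, hcd, not_false_eq_true, and_self]
  rcases le_max_iff.1 h with h | h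
  · exact le_max_of_le_left (by linarith)
  · exact le_max_of_le_right (by linarith)

/-- The inductive step of local-to-global exchange, phrased for a normalized function. -/
lemma LocalExchange.not_forall_lt {N : Type*} [DecidableEq N] {F : Finset N → ℝ}
    (hF : LocalExchange F) {A : Finset N} {x : N} (hxA : x ∈ A) :
    ∀ (n : ℕ) (B : Finset N), (A \ B).card = n → (B \ A).card = n → x ∉ B →
      (∀ y ∈ B \ A, F (insert y (A.erase x)) = F A) →
      ¬ ∀ y ∈ B \ A, F (insert x (B.erase y)) < F B := by
  intro n
  induction n with
  | zero =>
    intro B h _ hx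
    have : x ∈ A \ B := Finset.mem_sdiff.2 ⟨hxA, hx⟩
    simp [Finset.card_eq_zero.1 h] at this
  | succ n ih =>
    intro B hAB hBA hx heq hlt
    rcases Nat.eq_zero_or_pos n with rfl | hn
    · obtain ⟨y, hy⟩ := Finset.card_eq_one.1 hBA
      obtain ⟨z, hz⟩ := Finset.card_eq_one.1 hAB
      have hyB : y ∈ B \ A := by simp [hy]
      have e1 : insert y (A.erase x) = B := by
        ext t
        have h1 := Finset.ext_iff.1 hy t
        have h2 := Finset.ext_iff.1 hz t
        have h3 := Finset.ext_iff.1 hz x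
        simp only [Finset.mem_sdiff, Finset.mem_singleton, Finset.mem_insert,
          Finset.mem_erase] at *
        grind
      have e2 : insert x (B.erase y) = A := by
        rw [← e1, Finset.erase_insert (by simp [(Finset.mem_sdiff.1 hyB).2]),
          Finset.insert_erase hxA]
      have h1 := heq y hyB
      have h2 := hlt y hyB
      rw [e1] at h1
      rw [e2] at h2
      linarith
    · have hxAB : x ∈ A \ B := Finset.mem_sdiff.2 ⟨hxA, hx⟩
      obtain ⟨z, hz, hzx⟩ := Finset.exists_mem_ne (by omega : 1 < (A \ B).card) x
      have hne : (B \ A).Nonempty := Finset.card_pos.1 (by omega)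
      -- Moving `B` to its best neighbour containing `z` brings it closer to `A`; maximality of `y₀`
      -- preserves the strict inequalities.
      obtain ⟨y₀, hy₀, hmax⟩ := Finset.exists_max_image (B \ A)
        (fun y => F (insert z (B.erase y))) hne
      rw [Finset.mem_sdiff] at hz hy₀
      have hsd : insert z (B.erase y₀) \ A = (B \ A).erase y₀ := by
        ext t; simp only [Finset.mem_sdiff, Finset.mem_insert, Finset.mem_erase]; grind
      have hsd' : A \ insert z (B.erase y₀) = (A \ B).erase z := by
        ext t; simp only [Finset.mem_sdiff, Finset.mem_insert, Finset.mem_erase]; grind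
      refine ih (insert z (B.erase y₀)) ?_ ?_ ?_ ?_ ?_
      · rw [hsd', Finset.card_erase_of_mem (Finset.mem_sdiff.2 hz), hAB]; rfl
      · rw [hsd, Finset.card_erase_of_mem (Finset.mem_sdiff.2 hy₀), hBA]; rfl
      · simp [hx, hzx.symm]
      · intro y hy
        rw [hsd] at hy
        exact heq y (Finset.mem_of_mem_erase hy)
      · intro y hy
        rw [hsd] at hy
        obtain ⟨hyy, hyB⟩ := Finset.mem_erase.1 hy
        have hyB' := Finset.mem_sdiff.1 hyB
        have hzy : z ≠ y := fun h => hyB'.2 (h ▸ hz.1)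
        have hzy₀ : z ≠ y₀ := fun h => hy₀.2 (h ▸ hz.1)
        have hxy : x ≠ y := fun h => hyB'.2 (h ▸ hxA)
        have hxy₀ : x ≠ y₀ := fun h => hy₀.2 (h ▸ hxA)
        have key := hF ((B.erase y₀).erase y) x z y y₀ (by simp [hx]) (by simp [hz.2])
          (by simp) (by simp) hzx.symm hxy hxy₀ hzy hzy₀ hyy
        have e1 : insert x (insert z ((B.erase y₀).erase y)) =
            insert x ((insert z (B.erase y₀)).erase y) := by
          rw [Finset.erase_insert_of_ne hzy]
        have e2 : insert y (insert y₀ ((B.erase y₀).erase y)) = B := by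
          rw [Finset.insert_comm, Finset.insert_erase (by simp [hyy, hyB'.1]),
            Finset.insert_erase hy₀.1]
        have e3 : insert y ((B.erase y₀).erase y) = B.erase y₀ :=
          Finset.insert_erase (by simp [hyy, hyB'.1])
        have e4 : insert y₀ ((B.erase y₀).erase y) = B.erase y := by
          rw [Finset.erase_right_comm, Finset.insert_erase (by simp [hyy.symm, hy₀.1])]
        rw [e1, e2, e3, e4] at key
        have h1 := hmax y hyB
        have h2 := hlt y hyB
        have h3 := hlt y₀ (Finset.mem_sdiff.2 hy₀)
        rcases le_max_iff.1 key with h | h <;> linarith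

/-- The local exchange property implies the exchange property of valuated matroids. -/
theorem LocalExchange.exchange {N : Type*} [DecidableEq N] {F : Finset N → ℝ}
    (hF : LocalExchange F) {A B : Finset N} (hcard : A.card = B.card) {x : N} (hxA : x ∈ A)
    (hxB : x ∉ B) :
    ∃ y ∈ B \ A, F A + F B ≤ F (insert y (A.erase x)) + F (insert x (B.erase y)) := by
  by_contra! hcon
  -- These weights make every exchange at `A` neutral, so a failed exchange becomes a strict loss at
  -- `B` alone.
  set w : N → ℝ := fun y =>
    if y ∈ A then 0 else F A - F (insert y (A.erase x)) with hw
  have hwA : ∀ y ∈ A, w y = 0 := fun y hy => by simp [hw, hy]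
  have hsumA : ∑ t ∈ A, w t = 0 := Finset.sum_eq_zero hwA
  have hsumA' : ∑ t ∈ A.erase x, w t = 0 :=
    Finset.sum_eq_zero fun t ht => hwA t (Finset.mem_of_mem_erase ht)
  refine (hF.add_weight w).not_forall_lt hxA _ B rfl
    (Finset.card_sdiff_comm hcard).symm hxB ?_ ?_
  · intro y hy
    rw [Finset.mem_sdiff] at hy
    simp only [hsumA]
    rw [Finset.sum_insert (by simp [hy.2]), hsumA']
    simp [hw, hy.2]
  · intro y hy
    have h := hcon y hy
    rw [Finset.mem_sdiff] at hy
    have h1 := Finset.add_sum_erase B w hy.1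
    have h2 : w y = F A - F (insert y (A.erase x)) := by simp [hw, hy.2]
    rw [Finset.sum_insert (by simp [hxB]), hwA x hxA]
    linarith

/-! ### M♮-concave exchange from the local conditions -/

/-- Pairwise submodularity of a set function. -/
def PairSubmodular {M : Type*} [DecidableEq M] (f : Finset M → ℝ) : Prop :=
  ∀ (S : Finset M) (i j : M), i ∉ S → j ∉ S → i ≠ j →
    f (insert i (insert j S)) + f S ≤ f (insert i S) + f (insert j S)

/-- The condition on triples of items which, with submodularity, characterizes gross
substitutes. -/
def TripleCondition {M : Type*} [DecidableEq M] (f : Finset M → ℝ) : Prop :=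
  ∀ (S : Finset M) (i j k : M), i ∉ S → j ∉ S → k ∉ S → i ≠ j → i ≠ k → j ≠ k →
    f (insert i (insert j S)) + f (insert k S) ≤
      max (f (insert i S) + f (insert j (insert k S)))
        (f (insert j S) + f (insert i (insert k S)))

/-- The four-point inequality follows from the ultrametric inequalities given by the
condition on triples. -/
lemma TripleCondition.four_point {M : Type*} [DecidableEq M] {f : Finset M → ℝ}
    (hT : TripleCondition f) : LocalExchange f := by
  intro X a b c d ha hb hc hd hab hac had hbc hbd hcd
  have h1 := hT X a b c ha hb hc hab hac hbc
  have h2 := hT X a b d ha hb hd hab had hbd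
  have h3 := hT X c d a hc hd ha hcd hac.symm had.symm
  have h4 := hT X c d b hc hd hb hcd hbc.symm hbd.symm
  rw [Finset.insert_comm d a, Finset.insert_comm c a] at h3
  rw [Finset.insert_comm d b, Finset.insert_comm c b] at h4
  simp only [le_max_iff] at *
  -- With g(x,y) = f(xy) - f(x) - f(y) over `X`, the hypotheses read g(a,b) ≤ max(g(a,t), g(b,t))
  -- for t = c, d, and likewise for g(c,d). Each choice of maxima gives a contradiction by adding
  -- two or all four of them.
  by_contra! h
  rcases h1 with h1 | h1 <;> rcases h2 with h2 | h2 <;> rcases h3 with h3 | h3 <;>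
    rcases h4 with h4 | h4 <;> linarith [h.1, h.2]

/-- Extending a set function by dummy items gives a function with the local exchange
property. -/
lemma TripleCondition.localExchange_toLeft {M : Type*} [DecidableEq M] {f : Finset M → ℝ}
    (hS : PairSubmodular f) (hT : TripleCondition f) :
    LocalExchange fun S : Finset (M ⊕ ℕ) => f S.toLeft := by
  intro X a b c d ha hb hc hd hab hac had hbc hbd hcd
  have comm : ∀ s t : M, insert s (insert t X.toLeft) = insert t (insert s X.toLeft) :=
    fun s t => Finset.insert_comm s t _
  -- One dummy leaves the triple condition, two dummies in the same left-hand pair leave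
  -- submodularity, and every other case with dummies is an equality.
  rcases a with a | a <;> rcases b with b | b <;> rcases c with c | c <;> rcases d with d | d <;>
    simp only [Finset.toLeft_insert_inl, Finset.toLeft_insert_inr, ← Finset.mem_toLeft, ne_eq,
      Sum.inl.injEq, le_max_iff] at *
  · exact le_max_iff.1 (hT.four_point X.toLeft a b c d ha hb hc hd hab hac had hbc hbd hcd)
  · have := le_max_iff.1 (hT X.toLeft a b c ha hb hc hab hac hbc)
    grind
  · have := le_max_iff.1 (hT X.toLeft a b d ha hb hd hab had hbd)
    grind
  · have := hS X.toLeft a b ha hb hab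
    grind
  · have := le_max_iff.1 (hT X.toLeft c d a hc hd ha hcd (Ne.symm hac) (Ne.symm had))
    grind
  · grind
  · grind
  · grind
  · have := le_max_iff.1 (hT X.toLeft c d b hc hd hb hcd (Ne.symm hbc) (Ne.symm hbd))
    grind
  · grind
  · grind
  · grind
  · have := hS X.toLeft c d hc hd hcd
    grind
  · grind
  · grind
  · grind

/-- The exchange property of M♮-concave set functions. -/
theorem TripleCondition.exchange {M : Type*} [DecidableEq M] {f : Finset M → ℝ}
    (hS : PairSubmodular f) (hT : TripleCondition f) {A B : Finset M} {x : M} (hxA : x ∈ A)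
    (hxB : x ∉ B) :
    f A + f B ≤ f (A.erase x) + f (insert x B) ∨
      ∃ y ∈ B \ A, f A + f B ≤ f (insert y (A.erase x)) + f (insert x (B.erase y)) := by
  -- Padding each set with as many dummies as the other has items equalizes cardinalities; a dummy
  -- `y` means that `x` moves without replacement.
  obtain ⟨y, hy, h⟩ := (hT.localExchange_toLeft hS).exchange
    (A := A.disjSum (Finset.range B.card)) (B := B.disjSum (Finset.range A.card))
    (x := Sum.inl x) (by simp [add_comm]) (by simpa) (by simpa)
  have hl : ∀ (S : Finset (M ⊕ ℕ)) (t : M), (S.erase (Sum.inl t)).toLeft = S.toLeft.erase t := by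
    intro S t; ext; simp
  have hr : ∀ (S : Finset (M ⊕ ℕ)) (t : ℕ), (S.erase (Sum.inr t)).toLeft = S.toLeft := by
    intro S t; ext; simp
  rcases y with y | y
  · right
    refine ⟨y, by simpa using hy, by simpa [hl] using h⟩
  · left
    simpa [hl, hr] using h

/-! ### Gross substitutes from exchange -/

/-- Submodularity and the condition on triples imply gross substitutes. -/
theorem isGrossSubstitutes_of_local {M : Type*} [Fintype M] [DecidableEq M]
    (v : BundleValuation M) (hS : PairSubmodular fun S => (v S : ℝ))
    (hT : TripleCondition fun S => (v S : ℝ)) : IsGrossSubstitutes v := by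
  intro p q hpq A hA
  classical
  obtain ⟨B₀, -, hB₀⟩ := Finset.exists_max_image (Finset.univ : Finset (Finset M))
    (fun S => utility v S q) Finset.univ_nonempty
  -- With maximal overlap with `A`, a missing item `x` is contradictory: the exchange cannot gain at
  -- `A`, so it does not lose at `B` and enlarges the overlap.
  obtain ⟨B, hB, hmax⟩ := Finset.exists_max_image
    (Finset.univ.filter fun S : Finset M => S ∈ demand v q) (fun S => (S ∩ A).card)
    ⟨B₀, Finset.mem_filter.2 ⟨Finset.mem_univ _, fun T => hB₀ T (Finset.mem_univ T)⟩⟩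
  simp only [Finset.mem_filter, Finset.mem_univ, true_and] at hB hmax
  refine ⟨B, hB, ?_⟩
  rintro x ⟨hxA, hx⟩
  simp only [Finset.mem_coe, Set.mem_ofPred_eq] at hxA hx ⊢
  by_contra hxB
  have hxe := Finset.add_sum_erase A (fun x => (p x : ℝ)) hxA
  have hx' : (p x : ℝ) = q x := by rw [hx]
  rcases hT.exchange hS hxA hxB with h | ⟨y, hy, h⟩
  · have hA' := hA (A.erase x)
    have hmem : insert x B ∈ demand v q := by
      intro T
      refine (hB T).trans ?_
      simp only [utility] at *
      rw [Finset.sum_insert hxB]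
      linarith
    have hle := hmax _ hmem
    rw [Finset.insert_inter_of_mem hxA, Finset.card_insert_of_notMem (by simp [hxB])] at hle
    omega
  · rw [Finset.mem_sdiff] at hy
    have hA' := hA (insert y (A.erase x))
    have hye := Finset.add_sum_erase B (fun x => (q x : ℝ)) hy.1
    -- Dropping `y` from `B` saves at least what adding it to `A` costs.
    have hpy : (p y : ℝ) ≤ q y := hpq y
    have hmem : insert x (B.erase y) ∈ demand v q := by
      intro T
      refine (hB T).trans ?_
      simp only [utility] at *
      rw [Finset.sum_insert (by simp [hy.2])] at hA'
      rw [Finset.sum_insert (by simp [hxB])]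
      linarith
    have hle := hmax _ hmem
    rw [Finset.insert_inter_of_mem hxA, Finset.card_insert_of_notMem (by simp [hxB]),
      Finset.erase_inter, Finset.erase_eq_of_notMem (by simp [hy.2])] at hle
    omega

/-! ### Prices isolating a closest improvement -/

/-- If items of `S ⊆ A` are free, items outside `T` are prohibitively expensive, and `B` is the
only bundle between `S` and `T` that improves on `A`, then `B` is a closest improving bundle. -/
lemma mem_bundleArgmin_of_unique {M : Type*} [Fintype M] [DecidableEq M] (v : BundleValuation M)
    (p : PriceVector M) {A B S T : Finset M} (hSA : S ⊆ A) (hST : S ⊆ T)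
    (hS : ∀ x ∈ S, p x = 0)
    (hT : ∀ x ∉ T, (v Finset.univ : ℝ) - p x ≤ utility v A p)
    (hB : utility v A p < utility v B p)
    (huniq : ∀ C, S ⊆ C → C ⊆ T → utility v A p < utility v C p → C = B) :
    B ∈ bundleArgmin {C : Finset M | utility v C p > utility v A p}
      (fun C => ((C \ A) ∪ (A \ C)).card) := by
  refine ⟨hB, fun C (hC : utility v A p < utility v C p) => ?_⟩
  have hCT : C ⊆ T := by
    intro x hx
    by_contra hxT
    have h1 := hT x hxT
    have h2 : (p x : ℝ) ≤ ∑ t ∈ C, (p t : ℝ) :=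
      Finset.single_le_sum (f := fun t => (p t : ℝ)) (fun _ _ => NNReal.coe_nonneg _) hx
    have h3 : (v C : ℝ) ≤ v Finset.univ := v.mono _ _ (Finset.subset_univ C)
    unfold utility at hC h1
    linarith
  have hsum : ∑ t ∈ C ∪ S, (p t : ℝ) = ∑ t ∈ C, (p t : ℝ) := by
    symm
    refine Finset.sum_subset Finset.subset_union_left fun t ht htC => ?_
    simp [hS t ((Finset.mem_union.1 ht).resolve_left htC)]
  have hle : (v C : ℝ) ≤ v (C ∪ S) := v.mono _ _ Finset.subset_union_left
  -- Adding the free items of `S` keeps `C` improving, so `C ∪ S = B`; as `S ⊆ A`, this cannot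
  -- increase the distance to `A`.
  have hCS := huniq (C ∪ S) Finset.subset_union_right (Finset.union_subset hCT hST)
    (by unfold utility at hC ⊢; rw [hsum]; linarith)
  subst hCS
  refine Finset.card_le_card fun t => ?_
  have := @hSA t
  simp only [Finset.mem_union, Finset.mem_sdiff]
  tauto

/-- Splitting an interval of finite sets according to membership of one element. -/
lemma exists_between_of_subset_insert {M : Type*} [DecidableEq M] {i : M} {S T C : Finset M}
    (hi : i ∉ S) (hSC : S ⊆ C) (hCT : C ⊆ insert i T) :
    ∃ D, S ⊆ D ∧ D ⊆ T ∧ (C = D ∨ C = insert i D) := by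
  refine ⟨C.erase i, Finset.subset_erase.2 ⟨hSC, hi⟩, Finset.subset_insert_iff.1 hCT,
    ?_⟩
  by_cases h : i ∈ C
  · exact Or.inr (Finset.insert_erase h).symm
  · exact Or.inl (Finset.erase_eq_of_notMem h).symm

lemma utility_insert {M : Type*} [DecidableEq M] (v : BundleValuation M) (p : PriceVector M)
    {i : M} {S : Finset M} (hi : i ∉ S) :
    utility v (insert i S) p = v (insert i S) - (p i + ∑ x ∈ S, (p x : ℝ)) := by
  rw [utility, Finset.sum_insert hi]

/-- A violation of pairwise submodularity yields a bundle whose closest improvement adds two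
items. -/
lemma exists_closest_of_not_pairSubmodular {M : Type*} [Fintype M] [DecidableEq M]
    (v : BundleValuation M) {S : Finset M} {i j : M} (hi : i ∉ S) (hj : j ∉ S) (hij : i ≠ j)
    (h : (v (insert i S) : ℝ) + v (insert j S) < v (insert i (insert j S)) + v S) :
    ∃ p : PriceVector M,
      insert i (insert j S) ∈ bundleArgmin {C : Finset M | utility v C p > utility v S p}
        (fun C => ((C \ S) ∪ (S \ C)).card) := by
  have hmi : (v S : ℝ) ≤ v (insert i S) := v.mono _ _ (Finset.subset_insert _ _)
  have hmj : (v S : ℝ) ≤ v (insert j S) := v.mono _ _ (Finset.subset_insert _ _)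
  -- Priced at its marginal value over `S`, each item alone is neutral, while the pair is a strict
  -- gain.
  obtain ⟨a, ha⟩ : ∃ a : ℝ≥0, (a : ℝ) = v (insert i S) - v S := ⟨⟨_, sub_nonneg.2 hmi⟩, rfl⟩
  obtain ⟨b, hb⟩ : ∃ b : ℝ≥0, (b : ℝ) = v (insert j S) - v S := ⟨⟨_, sub_nonneg.2 hmj⟩, rfl⟩
  set p : PriceVector M := fun x =>
    if x ∈ S then 0 else if x = i then a else if x = j then b else v Finset.univ with hp
  have hpi : p i = a := by simp [hp, hi]
  have hpj : p j = b := by simp [hp, hj, hij.symm]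
  have hpS : ∀ x ∈ S, p x = 0 := fun x hx => by simp [hp, hx]
  have hsum : ∑ x ∈ S, (p x : ℝ) = 0 := Finset.sum_eq_zero fun x hx => by simp [hpS x hx]
  have hi' : i ∉ insert j S := by simp [hij, hi]
  have uS : utility v S p = v S := by simp [utility, hsum]
  have ui : utility v (insert i S) p = v S := by
    rw [utility_insert v p hi, hsum, hpi, ha]; ring
  have uj : utility v (insert j S) p = v S := by
    rw [utility_insert v p hj, hsum, hpj, hb]; ring
  have uij : utility v (insert i (insert j S)) p = v (insert i (insert j S)) - (a + b) := by
    rw [utility_insert v p hi', Finset.sum_insert hj, hsum, hpi, hpj, add_zero]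
  refine ⟨p, mem_bundleArgmin_of_unique v p (T := insert i (insert j S)) subset_rfl
    ((Finset.subset_insert _ _).trans (Finset.subset_insert _ _)) hpS ?_ ?_ ?_⟩
  · intro x hx
    simp only [Finset.mem_insert, not_or] at hx
    have : p x = v Finset.univ := by simp [hp, hx]
    rw [this, uS, sub_self]
    exact NNReal.coe_nonneg _
  · rw [uS, uij]
    linarith
  · intro C hSC hCT hC
    obtain ⟨D, hSD, hDT, hD⟩ := exists_between_of_subset_insert hi hSC hCT
    obtain ⟨E, hSE, hET, hE⟩ := exists_between_of_subset_insert hj hSD hDT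
    obtain rfl := Finset.Subset.antisymm hSE hET
    rcases hD with rfl | rfl <;> rcases hE with rfl | rfl
    · exact absurd hC (lt_irrefl _)
    · linarith
    · linarith
    · rfl

/-- The prices witnessing a violation of the condition on triples; all numbers are values of
bundles. -/
lemma exists_prices_of_triple {s si sj sk sij sik sjk : ℝ}
    (hj : sj ≤ sjk) (hik : sk ≤ sik) (hjk : sk ≤ sjk)
    (sub : sij + s ≤ si + sj) (h1 : si + sjk < sij + sk) (h2 : sj + sik < sij + sk) :
    ∃ a b c : ℝ, 0 ≤ a ∧ 0 ≤ b ∧ 0 ≤ c ∧ s ≤ sk - c ∧ sik - a ≤ sk ∧ sjk - b ≤ sk ∧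
      si - a ≤ sk - c ∧ sj - b ≤ sk - c ∧ sk - c < sij - (a + b) := by
  -- The interval is nonempty by `h1` with `hj`, and by `h1 + h2`. Its upper end and `sub` give `s ≤
  -- sk - c`.
  obtain ⟨c, hc1, hc2⟩ : ∃ c, max 0 (sik + sjk - sk - sij) < c ∧ c < sij + sk - si - sj :=
    exists_between (max_lt (by linarith) (by linarith))
  obtain ⟨hc0, hc1⟩ := max_lt_iff.1 hc1
  -- The least `a` and `b` meeting the four upper bounds on utilities; of the four cases for the
  -- maxima, the mixed ones use `h1` and `h2`, the others the bounds on `c`.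
  refine ⟨max (sik - sk) (c + si - sk), max (sjk - sk) (c + sj - sk), c,
    le_max_of_le_left (by linarith), le_max_of_le_left (by linarith), hc0.le, by linarith,
    ?_, ?_, ?_, ?_, ?_⟩
  · linarith [le_max_left (sik - sk) (c + si - sk)]
  · linarith [le_max_left (sjk - sk) (c + sj - sk)]
  · linarith [le_max_right (sik - sk) (c + si - sk)]
  · linarith [le_max_right (sjk - sk) (c + sj - sk)]
  · rcases max_choice (sik - sk) (c + si - sk) with h | h <;>
      rcases max_choice (sjk - sk) (c + sj - sk) with h' | h' <;> rw [h, h'] <;> linarith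

/-- For a submodular valuation, a violation of the condition on triples yields a bundle whose
closest improvement exchanges one item for two. -/
lemma exists_closest_of_not_tripleCondition {M : Type*} [Fintype M] [DecidableEq M]
    (v : BundleValuation M) (hsub : PairSubmodular fun S => (v S : ℝ)) {S : Finset M} {i j k : M}
    (hi : i ∉ S) (hj : j ∉ S) (hk : k ∉ S) (hij : i ≠ j) (hik : i ≠ k) (hjk : j ≠ k)
    (h1 : (v (insert i S) : ℝ) + v (insert j (insert k S)) <
      v (insert i (insert j S)) + v (insert k S))
    (h2 : (v (insert j S) : ℝ) + v (insert i (insert k S)) <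
      v (insert i (insert j S)) + v (insert k S)) :
    ∃ p : PriceVector M,
      insert i (insert j S) ∈
        bundleArgmin {C : Finset M | utility v C p > utility v (insert k S) p}
          (fun C => ((C \ insert k S) ∪ (insert k S \ C)).card) := by
  have mono : ∀ (x : M) (C : Finset M), (v C : ℝ) ≤ v (insert x C) :=
    fun x C => v.mono _ _ (Finset.subset_insert _ _)
  have hmj : (v (insert j S) : ℝ) ≤ v (insert j (insert k S)) := by
    rw [Finset.insert_comm]; exact mono _ _
  obtain ⟨a, b, c, ha, hb, hc, hS, hik', hjk', hi', hj', hB⟩ :=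
    exists_prices_of_triple hmj (mono i (insert k S)) (mono j (insert k S))
      (hsub S i j hi hj hij) h1 h2
  lift a to ℝ≥0 using ha
  lift b to ℝ≥0 using hb
  lift c to ℝ≥0 using hc
  have hik_mem : i ∉ insert k S := by simp [hik, hi]
  have hjk_mem : j ∉ insert k S := by simp [hjk, hj]
  have hij_mem : i ∉ insert j S := by simp [hij, hi]
  have hijk_mem : i ∉ insert j (insert k S) := by simp [hij, hik, hi]
  set p : PriceVector M := fun x =>
    if x ∈ S then 0 else if x = i then a else if x = j then b else if x = k then c
    else v Finset.univ with hp
  have hpi : p i = a := by simp [hp, hi]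
  have hpj : p j = b := by simp [hp, hj, hij.symm]
  have hpk : p k = c := by simp [hp, hk, hik.symm, hjk.symm]
  have hpS : ∀ x ∈ S, p x = 0 := fun x hx => by simp [hp, hx]
  have hsum : ∑ x ∈ S, (p x : ℝ) = 0 := Finset.sum_eq_zero fun x hx => by simp [hpS x hx]
  have uS : utility v S p = v S := by simp [utility, hsum]
  have uk : utility v (insert k S) p = v (insert k S) - c := by
    simp [utility_insert v p hk, hsum, hpk]
  have ui : utility v (insert i S) p = v (insert i S) - a := by
    simp [utility_insert v p hi, hsum, hpi]
  have uj : utility v (insert j S) p = v (insert j S) - b := by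
    simp [utility_insert v p hj, hsum, hpj]
  have uij : utility v (insert i (insert j S)) p = v (insert i (insert j S)) - (a + b) := by
    rw [utility_insert v p hij_mem, Finset.sum_insert hj, hsum, hpi, hpj, add_zero]
  have uik : utility v (insert i (insert k S)) p = v (insert i (insert k S)) - (a + c) := by
    rw [utility_insert v p hik_mem, Finset.sum_insert hk, hsum, hpi, hpk, add_zero]
  have ujk : utility v (insert j (insert k S)) p = v (insert j (insert k S)) - (b + c) := by
    rw [utility_insert v p hjk_mem, Finset.sum_insert hk, hsum, hpj, hpk, add_zero]
  have uijk : utility v (insert i (insert j (insert k S))) p =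
      v (insert i (insert j (insert k S))) - (a + (b + c)) := by
    rw [utility_insert v p hijk_mem, Finset.sum_insert hjk_mem, Finset.sum_insert hk, hsum, hpi,
      hpj, hpk, add_zero]
  -- Excludes `S ∪ {i, j, k}`: neither `i` nor `j` alone improves `S ∪ {k}`, so by submodularity
  -- both together do not.
  have hsubk := hsub (insert k S) i j hik_mem hjk_mem hij
  refine ⟨p, mem_bundleArgmin_of_unique v p (S := S) (T := insert i (insert j (insert k S)))
    (Finset.subset_insert _ _) ((Finset.subset_insert _ _).trans
      ((Finset.subset_insert _ _).trans (Finset.subset_insert _ _))) hpS ?_ ?_ ?_⟩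
  · intro x hx
    simp only [Finset.mem_insert, not_or] at hx
    have : p x = v Finset.univ := by simp [hp, hx]
    rw [this, uk, sub_self]
    exact (NNReal.coe_nonneg _).trans hS
  · rw [uk, uij]
    exact hB
  · intro C hSC hCT hC
    obtain ⟨D, hSD, hDT, hD⟩ := exists_between_of_subset_insert hi hSC hCT
    obtain ⟨E, hSE, hET, hE⟩ := exists_between_of_subset_insert hj hSD hDT
    obtain ⟨G, hSG, hGT, hG⟩ := exists_between_of_subset_insert hk hSE hET
    obtain rfl := Finset.Subset.antisymm hSG hGT
    rcases hD with rfl | rfl <;> rcases hE with rfl | rfl <;> rcases hG with rfl | rfl <;>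
      first | rfl | (exfalso; linarith)

theorem mainTheorem6 {M : Type*} [Fintype M] [DecidableEq M] (v : BundleValuation M)
    (hv : ¬ IsGrossSubstitutes v) :
    ∃ (A B : Finset M) (p : PriceVector M),
      (B \ A).card = 2 ∧
      (A \ B).card ≤ 1 ∧
      B ∈ bundleArgmin {C : Finset M | utility v C p > utility v A p}
        (fun C => ((C \ A) ∪ (A \ C)).card) := by
  by_cases hS : PairSubmodular fun S => (v S : ℝ)
  · have hT : ¬ TripleCondition fun S => (v S : ℝ) :=
      fun hT => hv (isGrossSubstitutes_of_local v hS hT)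
    simp only [TripleCondition, not_forall, not_le, max_lt_iff] at hT
    obtain ⟨S, i, j, k, hi, hj, hk, hij, hik, hjk, h1, h2⟩ := hT
    obtain ⟨p, hp⟩ := exists_closest_of_not_tripleCondition v hS hi hj hk hij hik hjk h1 h2
    refine ⟨insert k S, insert i (insert j S), p, ?_, ?_, hp⟩
    · have : insert i (insert j S) \ insert k S = {i, j} := by
        ext x; simp only [Finset.mem_sdiff, Finset.mem_insert, Finset.mem_singleton]; grind
      rw [this, Finset.card_pair hij]
    · rw [← Finset.card_singleton k]
      refine Finset.card_le_card fun x hx => ?_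
      simp only [Finset.mem_sdiff, Finset.mem_insert, Finset.mem_singleton] at hx ⊢
      tauto
  · simp only [PairSubmodular, not_forall, not_le] at hS
    obtain ⟨S, i, j, hi, hj, hij, h⟩ := hS
    obtain ⟨p, hp⟩ := exists_closest_of_not_pairSubmodular v hi hj hij h
    refine ⟨S, insert i (insert j S), p, ?_, ?_, hp⟩
    · have : insert i (insert j S) \ S = {i, j} := by
        ext x; simp only [Finset.mem_sdiff, Finset.mem_insert, Finset.mem_singleton]; grind
      rw [this, Finset.card_pair hij]
    · have : S \ insert i (insert j S) = ∅ :=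
        Finset.sdiff_eq_empty_iff_subset.2
          ((Finset.subset_insert _ _).trans (Finset.subset_insert _ _))
      simp [this]
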